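/- Throughout, a \emph{countable Borel equivalence relation} (CBER) is an equivalence relation $E$ on a standard Borel space $X$ that is a Borel subset of $X\times X$ and all of whose classes are countable. For CBERs $E$ on $X$ and $F$ on $Y$: - $E\cong_B F$ ($E$ and $F$ are \emph{Borel isomorphic}) means that there is a Borel isomorphism $T:X\to Y$ with $x\mathrel{E}x'\iff T(x)\mathrel{F}T(x')$; if $F=E$, such a $T$ is called a Borel automorphism of $E$. - $E$ and $F$ are \emph{Borel bireducible} if there are Borel maps $S:X\to Y$ and $T:Y\to X$ with $x\mathrel{E}x'\iff S(x)\mathrel{F}S(x')$ and $y\mathrel{F}y'\iff T(y)\mathrel{E}T(y')$. - $\bigoplus_i E_i$ denotes the direct sum, i.e. the equivalence relation on the disjoint union of the underlying spaces that agrees with each $E_i$ on its own space and relates no points of different summands; $E\oplus F$ is the case of two summands. $E\times I_{\mathbb N}$ is the equivalence relation on $X\times\mathbb N$ in which $(x,m)$ and $(x',n)$ are related iff $x\mathrel{E}x'$. - $E$ is \emph{compressible} if there is a Borel injection $T:X\to X$ with $T([x]_E)\subsetneq[x]_E$ for every $x\in X$. - A permutation $f$ of the quotient $X/E$ is \emph{Borel}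 if $\{(x,y)\in X\times X: f([x]_E)=[y]_E\}$ is Borel, and \emph{outer} if there is a Borel automorphism $T$ of $E$ with $f([x]_E)=[T(x)]_E$ for all $x\in X$. A \emph{Borel action} of a group $G$ on $X/E$ is an action of $G$ on $X/E$ by Borel permutations; it is \emph{outer} if every $g\in G$ acts by an outer permutation. \textbf{Proposition.} Let $G$ be a countable group and let $E$ be a CBER on a standard Borel space $X$. Suppose that every Borel action of $G$ on $X/E$ is outer. (1) Whenever $E\cong_B\bigoplus_{g\in G}E_g$, where $(E_g)_{g\in G}$ is a family of CBERs (on standard Borel spaces $X_g$) that are pairwise Borel bireducible, the $E_g$ are pairwise Borel isomorphic. (2) If $G$ is nontrivial and $E\cong_B E\oplus(E\times I_{\mathbb N})$, then $E$ is compressible. -/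

import Mathlib

/-- `E` is a countable Borel equivalence relation (CBER) on `X`. -/
structure IsCBER {X : Type*} [MeasurableSpace X] (E : Setoid X) : Prop where
  measurableSet_rel : MeasurableSet {p : X × X | E p.1 p.2}
  countable_class : ∀ x : X, {y : X | E x y}.Countable

/-- The direct sum `E ⊕ F` of two equivalence relations, on the disjoint union. -/
def Setoid.directSum {X Y : Type*} (E : Setoid X) (F : Setoid Y) : Setoid (X ⊕ Y) where
  r := Sum.LiftRel E F
  iseqv :=
    { refl := by
        rintro (x | y)
        · exact Sum.LiftRel.inl (E.refl x)
        · exact Sum.LiftRel.inr (F.refl y)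
      symm := by
        rintro _ _ (⟨h⟩ | ⟨h⟩)
        · exact Sum.LiftRel.inl (E.symm h)
        · exact Sum.LiftRel.inr (F.symm h)
      trans := by
        rintro _ _ _ (⟨h⟩ | ⟨h⟩) (⟨k⟩ | ⟨k⟩)
        · exact Sum.LiftRel.inl (E.trans h k)
        · exact Sum.LiftRel.inr (F.trans h k) }

/-- The direct sum `⨁ i, E i` of a family of equivalence relations, on the disjoint union
of the underlying sets. -/
def Setoid.directSigma {I : Type*} {X : I → Type*} (E : ∀ i, Setoid (X i)) :
    Setoid (Σ i, X i) where
  r := fun p q => ∃ (i : I) (x y : X i), E i x y ∧ p = ⟨i, x⟩ ∧ q = ⟨i, y⟩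
  iseqv :=
    { refl := fun p => ⟨p.1, p.2, p.2, (E p.1).refl p.2, rfl, rfl⟩
      symm := by
        rintro _ _ ⟨i, x, y, h, rfl, rfl⟩
        exact ⟨i, y, x, (E i).symm h, rfl, rfl⟩
      trans := by
        rintro _ _ _ ⟨i, x, y, h, rfl, rfl⟩ ⟨j, y', z, k, hy, rfl⟩
        cases hy
        exact ⟨i, x, z, (E i).trans h k, rfl, rfl⟩ }

/-- Borel isomorphism of equivalence relations: `E ≅_B F`. -/
def BorelIsomorphic {X Y : Type*} [MeasurableSpace X] [MeasurableSpace Y]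
    (E : Setoid X) (F : Setoid Y) : Prop :=
  ∃ T : X ≃ᵐ Y, ∀ x x' : X, E x x' ↔ F (T x) (T x')

/-- Borel reducibility: `E ≤_B F`. -/
def BorelReducible {X Y : Type*} [MeasurableSpace X] [MeasurableSpace Y]
    (E : Setoid X) (F : Setoid Y) : Prop :=
  ∃ T : X → Y, Measurable T ∧ ∀ x x' : X, E x x' ↔ F (T x) (T x')

/-- Borel bireducibility: `E ∼_B F`. -/
def BorelBireducible {X Y : Type*} [MeasurableSpace X] [MeasurableSpace Y]
    (E : Setoid X) (F : Setoid Y) : Prop :=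
  BorelReducible E F ∧ BorelReducible F E

/-- `E` is compressible: some Borel injection maps every class onto a proper subset of itself. -/
def Compressible {X : Type*} [MeasurableSpace X] (E : Setoid X) : Prop :=
  ∃ T : X → X, Measurable T ∧ Function.Injective T ∧
    ∀ x : X, T '' {y : X | E x y} ⊂ {y : X | E x y}

/-- A map `X/E → Y/F` is Borel if its graph lifts to a Borel subset of `X × Y`. -/
def IsBorelQuotientMap {X Y : Type*} [MeasurableSpace X] [MeasurableSpace Y]
    (E : Setoid X) (F : Setoid Y) (f : Quotient E → Quotient F) : Prop :=
  MeasurableSet {p : X × Y | f (Quotient.mk E p.1) = Quotient.mk F p.2}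

/-- A permutation of `X/E` is outer if it is induced by a Borel automorphism of `E`. -/
def IsOuterPerm {X : Type*} [MeasurableSpace X] (E : Setoid X)
    (f : Equiv.Perm (Quotient E)) : Prop :=
  ∃ T : X ≃ᵐ X, (∀ x y : X, E x y ↔ E (T x) (T y)) ∧
    ∀ x : X, f (Quotient.mk E x) = Quotient.mk E (T x)

/-- An action of `G` on the set `X/E` is a Borel action if every element of `G` acts by a
Borel permutation. -/
def IsBorelAction {G X : Type*} [Group G] [MeasurableSpace X] (E : Setoid X)
    (a : G →* Equiv.Perm (Quotient E)) : Prop :=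
  ∀ g : G, IsBorelQuotientMap E E (a g)

/-- An action of `G` on `X/E` is outer if every element of `G` acts by an outer permutation. -/
def IsOuterAction {G X : Type*} [Group G] [MeasurableSpace X] (E : Setoid X)
    (a : G →* Equiv.Perm (Quotient E)) : Prop :=
  ∀ g : G, IsOuterPerm E (a g)

open Set Filter Topology MeasureTheory

/-! For (1), a Borel Schröder–Bernstein argument (`BorelBireducible.exists_equiv`) identifies the
quotients of all summands with a single quotient Q. Then X/E becomes G × Q, and left multiplication
on G is a Borel action on X/E. Since it is outer, the Borel automorphism of E lifting h g⁻¹ carries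
the summand of index g onto that of index h (`borelIsomorphic_of_outer`).

For (2), absorbing E × I_ℕ gives infinitely many disjoint invariant copies of it inside X
(`exists_embeddings_of_borelIsomorphic_directSum`). Index copies by G and enlarge the one at 1 by
the rest of X. The resulting pieces are bireducible, hence isomorphic by (1). As G is nontrivial,
some piece is an exact copy of E × I_ℕ, which is compressible; so E is a direct sum of compressible
relations.

Borelness on quotients rests on the Lusin–Novikov theorem (`Measurable.isCountablyInjective_univ`).
It is proved by contradiction: if f is not countably injective, repeated splitting of open sets
produces a nonempty perfect set inside one fibre. -/

/-! ### The Lusin–Novikov theorem -/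

/-- A set is a countable union of Borel sets on each of which `f` is injective. -/
def IsCountablyInjective {X Y : Type*} [MeasurableSpace X] (f : X → Y) (C : Set X) : Prop :=
  ∃ 𝓑 : Set (Set X), 𝓑.Countable ∧ (∀ B ∈ 𝓑, MeasurableSet B ∧ InjOn f B) ∧ ⋃₀ 𝓑 = C

theorem IsCountablyInjective.empty {X Y : Type*} [MeasurableSpace X] (f : X → Y) :
    IsCountablyInjective f ∅ :=
  ⟨∅, countable_empty, by simp, by simp⟩

theorem IsCountablyInjective.of_injOn {X Y : Type*} [MeasurableSpace X] {f : X → Y} {B : Set X}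
    (hB : MeasurableSet B) (hf : InjOn f B) : IsCountablyInjective f B :=
  ⟨{B}, countable_singleton B, by simp [hB, hf], by simp⟩

theorem IsCountablyInjective.iUnion {ι X Y : Type*} [Countable ι] [MeasurableSpace X] {f : X → Y}
    {C : ι → Set X} (h : ∀ i, IsCountablyInjective f (C i)) :
    IsCountablyInjective f (⋃ i, C i) := by
  choose 𝓑 hc hm hu using h
  refine ⟨⋃ i, 𝓑 i, countable_iUnion hc, ?_, ?_⟩
  · intro B hB
    obtain ⟨i, hi⟩ := mem_iUnion.1 hB
    exact hm i B hi
  · rw [sUnion_iUnion]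
    simp_rw [hu]

theorem IsCountablyInjective.union {X Y : Type*} [MeasurableSpace X] {f : X → Y}
    {C D : Set X} (hC : IsCountablyInjective f C) (hD : IsCountablyInjective f D) :
    IsCountablyInjective f (C ∪ D) := by
  rw [union_eq_iUnion]
  exact .iUnion fun b => by cases b <;> assumption

theorem IsCountablyInjective.measurableSet {X Y : Type*} [MeasurableSpace X] {f : X → Y}
    {C : Set X} (hC : IsCountablyInjective f C) : MeasurableSet C := by
  obtain ⟨𝓑, hc, hm, rfl⟩ := hC
  exact .sUnion hc fun B hB => (hm B hB).1

theorem IsCountablyInjective.measurableSet_image {X Y : Type*} [MeasurableSpace X]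
    [StandardBorelSpace X] [MeasurableSpace Y] [MeasurableSpace.CountablySeparated Y] {f : X → Y}
    (hf : Measurable f) {C A : Set X}
    (hC : IsCountablyInjective f C) (hA : MeasurableSet A) (hAC : A ⊆ C) :
    MeasurableSet (f '' A) := by
  obtain ⟨𝓑, hc, hm, rfl⟩ := hC
  have : A = ⋃ B ∈ 𝓑, A ∩ B := by
    rw [← inter_iUnion₂, ← sUnion_eq_biUnion, inter_eq_left.2 hAC]
  rw [this, image_iUnion₂]
  exact .biUnion hc fun B hB => (hA.inter (hm B hB).1).image_of_measurable_injOn hf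
    ((hm B hB).2.mono inter_subset_right)

/-- A Borel map injective on a set with analytic partial images is injective on a Borel
superset. -/
theorem exists_measurableSet_superset_injOn {X Y : Type*} [TopologicalSpace X]
    [SecondCountableTopology X] [T2Space X] [MeasurableSpace X] [OpensMeasurableSpace X]
    [TopologicalSpace Y] [T2Space Y] [MeasurableSpace Y] [OpensMeasurableSpace Y]
    {f : X → Y} (hf : Measurable f) {A : Set X} (hinj : InjOn f A)
    (hA : ∀ V, IsOpen V → AnalyticSet (f '' (A ∩ V))) :
    ∃ B, MeasurableSet B ∧ A ⊆ B ∧ InjOn f B := by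
  let b := TopologicalSpace.countableBasis X
  have hb := TopologicalSpace.isBasis_countableBasis X
  have hbc : b.Countable := TopologicalSpace.countable_countableBasis X
  let P := {p : b × b // Disjoint p.1.1 p.2.1}
  have : Countable b := hbc.to_subtype
  -- Injectivity on `A` makes these two analytic images disjoint, so Lusin separation applies.
  have key (p : P) : MeasurablySeparable (f '' (A ∩ p.1.1)) (f '' (A ∩ p.1.2)) := by
    refine (hA _ (hb.isOpen p.1.1.2)).measurablySeparable (hA _ (hb.isOpen p.1.2.2)) ?_
    rw [disjoint_left]
    rintro _ ⟨x, hx, rfl⟩ ⟨x', hx', he⟩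
    cases hinj hx'.1 hx.1 he
    exact disjoint_left.1 p.2 hx.2 hx'.2
  choose D h1 h2 hD using key
  -- The superset keeps the points whose image lies on the correct side of every separating set `D
  -- p`; distinct points lie in some disjoint basic pair, so their images differ.
  refine ⟨⋂ p : P, ((p.1.1 : Set X)ᶜ ∪ f ⁻¹' D p) ∩ ((p.1.2 : Set X)ᶜ ∪ (f ⁻¹' D p)ᶜ),
    ?_, ?_, ?_⟩
  · refine .iInter fun p => ?_
    exact ((hb.isOpen p.1.1.2).measurableSet.compl.union (hf (hD p))).inter
      ((hb.isOpen p.1.2.2).measurableSet.compl.union (hf (hD p)).compl)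
  · intro x hx
    refine mem_iInter.2 fun p => ⟨?_, ?_⟩
    · by_cases h : x ∈ (p.1.1 : Set X)
      · exact Or.inr (h1 p ⟨x, ⟨hx, h⟩, rfl⟩)
      · exact Or.inl h
    · by_cases h : x ∈ (p.1.2 : Set X)
      · exact Or.inr (disjoint_left.1 (h2 p) ⟨x, ⟨hx, h⟩, rfl⟩)
      · exact Or.inl h
  · intro x hx x' hx' he
    by_contra hne
    obtain ⟨u, v, hu, hv, hxu, hxv, huv⟩ := t2_separation hne
    obtain ⟨u', hu', hxu', hu'u⟩ := hb.exists_subset_of_mem_open hxu hu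
    obtain ⟨v', hv', hxv', hv'v⟩ := hb.exists_subset_of_mem_open hxv hv
    let p : P := ⟨(⟨u', hu'⟩, ⟨v', hv'⟩), huv.mono hu'u hv'v⟩
    have e1 := ((mem_iInter.1 hx p).1.resolve_left (fun h => h hxu') : f x ∈ D p)
    have e2 := ((mem_iInter.1 hx' p).2.resolve_left (fun h => h hxv') : f x' ∉ D p)
    exact e2 (show f x' ∈ D p from he ▸ e1)

/-- A finite family of sets is `f`-large if, after removing any countably injective set, its
members still meet a common fibre of `f`. -/
def IsFiberLarge {X Y ι : Type*} [MeasurableSpace X] (f : X → Y) (s : Finset ι) (U : ι → Set X) :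
    Prop :=
  ∀ C, IsCountablyInjective f C → ∃ y, ∀ i ∈ s, ∃ x ∈ U i \ C, f x = y

/-- If every admissible basic pair failed, remove the union `D` of the countably injective
witnesses. The points of `U k \ D` whose fibre meets every `U i \ D` then form a set on which `f` is
injective, since two of them in one fibre would be separated by an admissible pair. Covering this
set by a Borel injectivity set `B`, the removal of `D ∪ B` contradicts largeness. -/
theorem IsFiberLarge.exists_split {X Y ι : Type*} [MetricSpace X] [PolishSpace X]
    [MeasurableSpace X] [BorelSpace X] [TopologicalSpace Y] [PolishSpace Y] [MeasurableSpace Y]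
    [BorelSpace Y] [DecidableEq ι] {f : X → Y} (hf : Measurable f) {s : Finset ι} {U : ι → Set X}
    (hU : ∀ i, IsOpen (U i)) (hL : IsFiberLarge f s U) {k m : ι} (hk : k ∈ s) (hm : m ∉ s)
    {ε : ℝ} (hε : 0 < ε) :
    ∃ V V' : Set X, IsOpen V ∧ IsOpen V' ∧ V ⊆ U k ∧ V' ⊆ U k ∧ (∃ c, V ⊆ Metric.ball c ε) ∧
      (∃ c, V' ⊆ Metric.ball c ε) ∧ Disjoint (closure V) (closure V') ∧
      IsFiberLarge f (insert m s) (Function.update (Function.update U k V) m V') := by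
  by_contra! hno
  let b := TopologicalSpace.countableBasis X
  have hb := TopologicalSpace.isBasis_countableBasis X
  have hbc : b.Countable := TopologicalSpace.countable_countableBasis X
  have : Countable b := hbc.to_subtype
  have key (p : b × b) : ∃ C, IsCountablyInjective f C ∧ (p.1.1 ⊆ U k → p.2.1 ⊆ U k →
      (∃ c, p.1.1 ⊆ Metric.ball c ε) → (∃ c, p.2.1 ⊆ Metric.ball c ε) →
      Disjoint (closure p.1.1) (closure p.2.1) → ∀ y, ∃ i ∈ insert m s,
        ∀ x ∈ Function.update (Function.update U k p.1.1) m p.2.1 i \ C, f x ≠ y) := by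
    by_cases h : p.1.1 ⊆ U k ∧ p.2.1 ⊆ U k ∧ (∃ c, p.1.1 ⊆ Metric.ball c ε) ∧
      (∃ c, p.2.1 ⊆ Metric.ball c ε) ∧ Disjoint (closure p.1.1) (closure p.2.1)
    · have h' := hno _ _ (hb.isOpen p.1.2) (hb.isOpen p.2.2) h.1 h.2.1 h.2.2.1 h.2.2.2.1 h.2.2.2.2
      unfold IsFiberLarge at h'
      push Not at h'
      obtain ⟨C, hC, hy⟩ := h'
      exact ⟨C, hC, fun _ _ _ _ _ => hy⟩
    · exact ⟨∅, .empty f, fun h1 h2 h3 h4 h5 => absurd ⟨h1, h2, h3, h4, h5⟩ h⟩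
  choose C hC hCy using key
  let D := ⋃ p, C p
  have hD : IsCountablyInjective f D := .iUnion hC
  let A : Set X := {x | x ∈ U k \ D ∧ ∀ i ∈ s, f x ∈ f '' (U i \ D)}
  have hinj : InjOn f A := by
    intro x hx x' hx' he
    by_contra hne
    obtain ⟨u, hxu, hu, v, hxv, hv, huv⟩ := exists_open_nhds_disjoint_closure hne
    have aux {z : X} {w : Set X} (hz : z ∈ U k) (hw : IsOpen w) (hzw : z ∈ w) :
        ∃ w' : b, z ∈ w'.1 ∧ w'.1 ⊆ w ∧ w'.1 ⊆ U k ∧ ∃ c, w'.1 ⊆ Metric.ball c ε := by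
      obtain ⟨w', h1, h2, h3⟩ := hb.exists_subset_of_mem_open
        (show z ∈ w ∩ (U k ∩ Metric.ball z ε) from ⟨hzw, hz, Metric.mem_ball_self hε⟩)
        (hw.inter ((hU k).inter Metric.isOpen_ball))
      exact ⟨⟨w', h1⟩, h2, fun t ht => (h3 ht).1, fun t ht => (h3 ht).2.1, z,
        fun t ht => (h3 ht).2.2⟩
    obtain ⟨V, hV1, hV2, hV3, hV4⟩ := aux hx.1.1 hu hxu
    obtain ⟨W, hW1, hW2, hW3, hW4⟩ := aux hx'.1.1 hv hxv
    obtain ⟨i, hi, h⟩ := hCy (V, W) hV3 hW3 hV4 hW4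
      (huv.mono (closure_mono hV2) (closure_mono hW2)) (f x)
    have hDp : ∀ z, z ∉ D → z ∉ C (V, W) := fun z hz hzC => hz (mem_iUnion.2 ⟨_, hzC⟩)
    by_cases him : i = m
    · subst him
      exact h x' ⟨by simpa using hW1, hDp _ hx'.1.2⟩ he.symm
    by_cases hik : i = k
    · subst hik
      exact h x ⟨by simpa [him] using hV1, hDp _ hx.1.2⟩ rfl
    obtain ⟨z, hz, hzf⟩ := hx.2 i ((Finset.mem_insert.1 hi).resolve_left him)
    exact h z ⟨by simpa [him, hik] using hz.1, hDp _ hz.2⟩ hzf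
  have hUD (i : ι) : MeasurableSet (U i \ D) := (hU i).measurableSet.diff hD.measurableSet
  have hA (V : Set X) (hV : IsOpen V) : AnalyticSet (f '' (A ∩ V)) := by
    -- Apart from `x ∈ U k \ D`, membership of `x` in `A` depends only on `f x`, so the image is an
    -- intersection of analytic sets.
    have e : f '' (A ∩ V) =
        ⋂ o : Option s, o.elim (f '' ((U k \ D) ∩ V)) (fun i => f '' (U i \ D)) := by
      ext y
      simp only [mem_iInter, Option.forall, Option.elim]
      constructor
      · rintro ⟨x, ⟨hx, hxV⟩, rfl⟩
        exact ⟨⟨x, ⟨hx.1, hxV⟩, rfl⟩, fun i => hx.2 i i.2⟩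
      · rintro ⟨⟨x, ⟨hx, hxV⟩, rfl⟩, h⟩
        exact ⟨x, ⟨⟨hx, fun i hi => h ⟨i, hi⟩⟩, hxV⟩, rfl⟩
    rw [e]
    refine AnalyticSet.iInter fun o => ?_
    cases o with
    | none => exact ((hUD k).inter hV.measurableSet).analyticSet_image hf
    | some i => exact (hUD i).analyticSet_image hf
  obtain ⟨B, hBm, hAB, hBi⟩ := exists_measurableSet_superset_injOn hf hinj hA
  obtain ⟨y, hy⟩ := hL (D ∪ B) (hD.union (.of_injOn hBm hBi))
  obtain ⟨x, ⟨hxU, hxD⟩, rfl⟩ := hy k hk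
  refine hxD (Or.inr (hAB ⟨⟨hxU, fun h => hxD (Or.inl h)⟩, fun i hi => ?_⟩))
  obtain ⟨z, hz, hzf⟩ := hy i hi
  exact ⟨z, ⟨hz.1, fun h => hz.2 (Or.inl h)⟩, hzf⟩

/-- Stage `m` splits the set of index `m.unpair.1`, which is at most `m`, and gives one half the new
index `m + 1`. Unpairing returns to every index infinitely often, with balls of radius tending to 0.
-/
theorem IsFiberLarge.exists_seq {X Y : Type*} [MetricSpace X] [PolishSpace X]
    [MeasurableSpace X] [BorelSpace X] [TopologicalSpace Y] [PolishSpace Y] [MeasurableSpace Y]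
    [BorelSpace Y] {f : X → Y} (hf : Measurable f) (h : IsFiberLarge f {0} fun _ : ℕ => univ) :
    ∃ U : ℕ → ℕ → Set X, (∀ m, IsFiberLarge f (Finset.range (m + 1)) (U m)) ∧
      (∀ m, ∀ i ≤ m, U (m + 1) i ⊆ U m i) ∧
      (∀ m, U (m + 1) (m + 1) ⊆ U m m.unpair.1) ∧
      (∀ m, ∃ c, U (m + 1) m.unpair.1 ⊆ Metric.ball c (1 / ((m : ℝ) + 1))) ∧
      ∀ m, Disjoint (closure (U (m + 1) m.unpair.1)) (closure (U (m + 1) (m + 1))) := by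
  let good (m : ℕ) (U : ℕ → Set X) : Prop :=
    (∀ i, IsOpen (U i)) ∧ IsFiberLarge f (Finset.range (m + 1)) U
  have step (m : ℕ) (U : {U // good m U}) : ∃ U' : {U // good (m + 1) U},
      (∀ i ≤ m, U'.1 i ⊆ U.1 i) ∧ U'.1 (m + 1) ⊆ U.1 m.unpair.1 ∧
      (∃ c, U'.1 m.unpair.1 ⊆ Metric.ball c (1 / ((m : ℝ) + 1))) ∧
      Disjoint (closure (U'.1 m.unpair.1)) (closure (U'.1 (m + 1))) := by
    obtain ⟨U, hUo, hUL⟩ := U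
    have hk : m.unpair.1 ≤ m := Nat.unpair_left_le m
    obtain ⟨V, V', hV, hV', hVU, hVU', hc, -, hd, hL⟩ := hUL.exists_split hf hUo
      (k := m.unpair.1) (m := m + 1) (by simpa [Nat.lt_succ_iff] using hk) (by simp)
      (ε := 1 / ((m : ℝ) + 1)) (by positivity)
    have hkm : m.unpair.1 ≠ m + 1 := by omega
    rw [← Finset.range_add_one] at hL
    refine ⟨⟨_, ⟨fun i => ?_, hL⟩⟩, ?_, ?_, ?_, ?_⟩
    · by_cases h1 : i = m + 1
      · simpa [h1] using hV'
      by_cases h2 : i = m.unpair.1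
      · rw [h2]; simpa [hkm] using hV
      · simpa [h1, h2] using hUo i
    · intro i hi
      have h1 : i ≠ m + 1 := by omega
      by_cases h2 : i = m.unpair.1
      · rw [h2]; simpa [hkm] using hVU
      · simp [h1, h2]
    · simpa using hVU'
    · simpa [hkm] using hc
    · simpa [hkm] using hd
  choose F hF using step
  let U : ∀ m, {U // good m U} :=
    fun m => Nat.rec ⟨fun _ => univ, fun _ => isOpen_univ, h⟩ (fun m U => F m U) m
  have hU (m : ℕ) : U (m + 1) = F m (U m) := rfl
  refine ⟨fun m => (U m).1, fun m => (U m).2.2, fun m => ?_, fun m => ?_, fun m => ?_, fun m => ?_⟩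
  · simp only [hU]; exact (hF m (U m)).1
  · simp only [hU]; exact (hF m (U m)).2.1
  · simp only [hU]; exact (hF m (U m)).2.2.1
  · simp only [hU]; exact (hF m (U m)).2.2.2

/-- At each stage choose points of all the current sets in a common fibre. For a fixed index they
converge, and by continuity all the limits lie in one fibre, which is closed. The splittings make
the set of limits dense in itself, so its closure is a perfect subset of that fibre. -/
theorem IsFiberLarge.exists_not_countable_fiber {X Y : Type*} [MetricSpace X] [CompleteSpace X]
    [SecondCountableTopology X] [MeasurableSpace X] [BorelSpace X] [TopologicalSpace Y]
    [PolishSpace Y] [MeasurableSpace Y] [BorelSpace Y] {f : X → Y} (hf : Continuous f)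
    (h : IsFiberLarge f {0} fun _ : ℕ => univ) : ∃ y, ¬ (f ⁻¹' {y}).Countable := by
  obtain ⟨U, hL, hmono, hsub, hdiam, hdisj⟩ := h.exists_seq hf.measurable
  have hanti {i m n : ℕ} (him : i ≤ m) (hmn : m ≤ n) : U n i ⊆ U m i := by
    induction n, hmn using Nat.le_induction with
    | base => exact subset_rfl
    | succ n hn ih => exact (hmono n i (him.trans hn)).trans ih
  have hsmall (k : ℕ) {ε : ℝ} (hε : 0 < ε) : ∃ N ≥ k, ∃ c, ∀ n ≥ N, U n k ⊆ Metric.ball c ε := by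
    obtain ⟨j, hj⟩ := exists_nat_one_div_lt hε
    have hp := Nat.right_le_pair k j
    obtain ⟨c, hc⟩ := hdiam (Nat.pair k j)
    rw [Nat.unpair_pair] at hc
    have hk : k ≤ Nat.pair k j + 1 := (Nat.left_le_pair k j).trans (Nat.le_succ _)
    refine ⟨_, hk, c, fun n hn => ((hanti hk hn).trans hc).trans (Metric.ball_subset_ball ?_)⟩
    refine le_trans (one_div_le_one_div_of_le (by positivity) ?_) hj.le
    exact_mod_cast Nat.add_le_add_right hp 1
  choose y hy using fun m => hL m ∅ (.empty f)
  have hp (m i : ℕ) : ∃ x, i ≤ m → x ∈ U m i ∧ f x = y m := by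
    by_cases him : i ≤ m
    · obtain ⟨x, hx, hxy⟩ := hy m i (by simpa [Nat.lt_succ_iff] using him)
      exact ⟨x, fun _ => ⟨hx.1, hxy⟩⟩
    · obtain ⟨x, -, -⟩ := hy m 0 (by simp)
      exact ⟨x, fun h => absurd h him⟩
  choose p hp using hp
  have hlim (k : ℕ) : ∃ x, Tendsto (fun m => p m k) atTop (𝓝 x) := by
    refine cauchySeq_tendsto_of_complete (Metric.cauchySeq_iff'.2 fun ε hε => ?_)
    obtain ⟨N, hN, c, hc⟩ := hsmall k (half_pos hε)
    refine ⟨N, fun n hn => ?_⟩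
    have h1 := hc n hn (hp n k (hN.trans hn)).1
    have h2 := hc N le_rfl (hp N k hN).1
    rw [Metric.mem_ball] at h1 h2
    linarith [dist_triangle_right (p n k) (p N k) c]
  choose x hx using hlim
  have hxU {k m : ℕ} (hkm : k ≤ m) : x k ∈ closure (U m k) :=
    mem_closure_of_tendsto (hx k) ((eventually_ge_atTop m).mono fun n hn =>
      hanti hkm hn (hp n k (hkm.trans hn)).1)
  have hfx (k : ℕ) : Tendsto y atTop (𝓝 (f (x k))) :=
    ((hf.tendsto _).comp (hx k)).congr' ((eventually_ge_atTop k).mono fun n hn => (hp n k hn).2)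
  have hpre : Preperfect (range x) := by
    rw [preperfect_iff_nhds]
    rintro _ ⟨k, rfl⟩ V hV
    obtain ⟨ε, hε, hεV⟩ := Metric.mem_nhds_iff.1 hV
    obtain ⟨N, hN, c, hc⟩ := hsmall k (half_pos (half_pos hε))
    -- At this stage index `k` is split and `U m k` is already small: `x (m + 1)` is close to `x k`,
    -- and disjoint closures make it different.
    let m := Nat.pair k N
    have hkm : k ≤ m := Nat.left_le_pair k N
    have hm1 : m.unpair.1 = k := by simp [m]
    have hcl : closure (U m k) ⊆ Metric.closedBall c (ε / 2 / 2) :=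
      (closure_mono (hc m (Nat.right_le_pair k N))).trans Metric.closure_ball_subset_closedBall
    have hs := hsub m
    have hd := hdisj m
    rw [hm1] at hs hd
    have h1 := hcl (hxU hkm)
    have h2 := hcl (closure_mono hs (hxU le_rfl))
    refine ⟨x (m + 1), ⟨hεV ?_, mem_range_self _⟩, fun he => ?_⟩
    · rw [Metric.mem_closedBall] at h1 h2
      rw [Metric.mem_ball]
      linarith [dist_triangle_right (x (m + 1)) (x k) c]
    · exact disjoint_left.1 hd (hxU (hkm.trans (Nat.le_succ m))) (he ▸ hxU le_rfl)
  refine ⟨f (x 0), fun hcount => ?_⟩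
  obtain ⟨g, hg, -, hginj⟩ := hpre.perfect_closure.exists_nat_bool_injection
    ((range_nonempty x).closure)
  have hsubset : closure (range x) ⊆ f ⁻¹' {f (x 0)} := by
    refine closure_minimal ?_ (isClosed_singleton.preimage hf)
    rintro _ ⟨k, rfl⟩
    exact tendsto_nhds_unique (hfx k) (hfx 0)
  have : Countable (ℕ → Bool) := by
    have h3 : (range g).Countable := hcount.mono (hg.trans hsubset)
    have := h3.to_subtype
    exact (rangeFactorization_injective.2 hginj).countable
  obtain ⟨e, he⟩ := exists_surjective_nat (ℕ → Bool)
  obtain ⟨n, hn⟩ := he fun n => !e n n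
  simpa using congrFun hn n

/-- **Lusin–Novikov**: a countable-to-one Borel map is injective on each of countably many Borel
sets covering its domain. -/
theorem Measurable.isCountablyInjective_univ {X Y : Type*} [MeasurableSpace X]
    [StandardBorelSpace X] [MeasurableSpace Y] [StandardBorelSpace Y] {f : X → Y}
    (hf : Measurable f) (hc : ∀ y, (f ⁻¹' {y}).Countable) : IsCountablyInjective f univ := by
  let := upgradeStandardBorel X
  let := upgradeStandardBorel Y
  -- A finer Polish topology makes `f` continuous; comparable Polish topologies have the same Borel
  -- sets.
  obtain ⟨t', hle, hcont, hpol⟩ := hf.exists_continuous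
  have hborel : @BorelSpace X t' _ := by
    let := t'
    refine ⟨?_⟩
    rw [eq_borel_upgradeStandardBorel X]
    exact (borel_eq_borel_of_le hpol UpgradedStandardBorel.toPolishSpace hle).symm
  by_contra hno
  let := t'
  let := TopologicalSpace.upgradeIsCompletelyMetrizable X
  have hlarge : IsFiberLarge f {0} fun _ : ℕ => (univ : Set X) := by
    intro C hC
    have : C ≠ univ := fun h => hno (h ▸ hC)
    obtain ⟨x, hx⟩ := (ne_univ_iff_exists_notMem C).1 this
    exact ⟨f x, fun _ _ => ⟨x, ⟨mem_univ x, hx⟩, rfl⟩⟩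
  obtain ⟨y, hy⟩ := hlarge.exists_not_countable_fiber hcont
  exact hy (hc y)

theorem MeasurableSet.image_of_countable_preimage {X Y : Type*} [MeasurableSpace X]
    [StandardBorelSpace X] [MeasurableSpace Y] [StandardBorelSpace Y] {f : X → Y} {s : Set X}
    (hs : MeasurableSet s) (hf : Measurable f) (hc : ∀ y, {x ∈ s | f x = y}.Countable) :
    MeasurableSet (f '' s) := by
  have : StandardBorelSpace s := hs.standardBorel
  have hfs : Measurable (fun x : s => f x) := hf.comp measurable_subtype_coe
  have h := hfs.isCountablyInjective_univ fun y =>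
    ((hc y).preimage Subtype.val_injective).mono fun x hx => (⟨x.2, hx⟩ : _ ∧ _)
  have := h.measurableSet_image hfs MeasurableSet.univ subset_rfl
  rwa [image_univ, ← image_eq_range] at this

/-! ### Borel maps between quotients -/

section Quotients

variable {X Y Z : Type*} [MeasurableSpace X] [MeasurableSpace Y] [MeasurableSpace Z]
  {E : Setoid X} {F : Setoid Y} {H : Setoid Z}

theorem BorelReducible.exists_injective (hF : IsCBER F) (h : BorelReducible E F) :
    ∃ f : Quotient E → Quotient F, Function.Injective f ∧ IsBorelQuotientMap E F f := by
  obtain ⟨S, hS, hSr⟩ := h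
  refine ⟨Quotient.map S fun x x' hx => (hSr x x').1 hx, ?_, ?_⟩
  · rintro ⟨x⟩ ⟨x'⟩ he
    exact Quotient.sound ((hSr x x').2 (Quotient.exact he))
  · have : {p : X × Y | F (S p.1) p.2} = {p : X × Y | Quotient.map S
        (fun x x' hx => (hSr x x').1 hx) (Quotient.mk E p.1) = Quotient.mk F p.2} := by
      ext p
      exact ⟨fun h => Quotient.sound h, fun h => Quotient.exact h⟩
    unfold IsBorelQuotientMap
    rw [← this]
    exact ((hS.comp measurable_fst).prodMk measurable_snd) hF.measurableSet_rel

/-- Measurable sets of a quotient are those with Borel preimage. Here the preimage is the projection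
of part of the lifted graph; injectivity confines each fibre of the projection to one `E`-class, so
it is countable. -/
theorem IsBorelQuotientMap.measurableSet_image [StandardBorelSpace X] [StandardBorelSpace Y]
    (hE : IsCBER E) {f : Quotient E → Quotient F} (hf : IsBorelQuotientMap E F f)
    (hinj : Function.Injective f) {A : Set (Quotient E)} (hA : MeasurableSet A) :
    MeasurableSet (f '' A) := by
  change MeasurableSet (Quotient.mk F ⁻¹' (f '' A))
  replace hA : MeasurableSet (Quotient.mk E ⁻¹' A) := hA
  have : Quotient.mk F ⁻¹' (f '' A) = Prod.snd ''
      ({p : X × Y | f (Quotient.mk E p.1) = Quotient.mk F p.2} ∩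
        Prod.fst ⁻¹' (Quotient.mk E ⁻¹' A)) := by
    ext y
    constructor
    · rintro ⟨⟨x⟩, hx, he⟩
      exact ⟨(x, y), ⟨he, hx⟩, rfl⟩
    · rintro ⟨⟨x, y⟩, ⟨he, hx⟩, rfl⟩
      exact ⟨_, hx, he⟩
  rw [this]
  refine (hf.inter (measurable_fst hA)).image_of_countable_preimage measurable_snd fun y => ?_
  by_cases hne : ∃ x₀, f (Quotient.mk E x₀) = Quotient.mk F y
  · obtain ⟨x₀, hx₀⟩ := hne
    refine ((hE.countable_class x₀).image fun x => (x, y)).mono ?_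
    rintro ⟨x, y'⟩ ⟨⟨he, -⟩, rfl⟩
    exact ⟨x, Quotient.exact (hinj (hx₀.trans (Eq.symm he))), rfl⟩
  · convert! countable_empty
    rw [eq_empty_iff_forall_notMem]
    rintro ⟨x, y'⟩ ⟨⟨he, -⟩, rfl⟩
    exact hne ⟨x, he⟩

/-- The composite graph is obtained by projecting away a middle coordinate that ranges over a single
`F`-class, so the projection is countable-to-one. -/
theorem IsBorelQuotientMap.comp [StandardBorelSpace X] [StandardBorelSpace Y]
    [StandardBorelSpace Z] (hF : IsCBER F) {f : Quotient E → Quotient F}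
    {f' : Quotient F → Quotient H} (hf' : IsBorelQuotientMap F H f')
    (hf : IsBorelQuotientMap E F f) : IsBorelQuotientMap E H (f' ∘ f) := by
  have : {p : X × Z | (f' ∘ f) (Quotient.mk E p.1) = Quotient.mk H p.2} =
      (fun q : X × Y × Z => (q.1, q.2.2)) ''
        ({q | f (Quotient.mk E q.1) = Quotient.mk F q.2.1} ∩
          {q | f' (Quotient.mk F q.2.1) = Quotient.mk H q.2.2}) := by
    ext ⟨x, z⟩
    constructor
    · intro h
      obtain ⟨y, hy⟩ := Quotient.exists_rep (f (Quotient.mk E x))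
      refine ⟨(x, y, z), ⟨hy.symm, ?_⟩, rfl⟩
      change f' (Quotient.mk F y) = _
      rw [hy]
      exact h
    · rintro ⟨⟨x', y, z'⟩, ⟨h1, h2⟩, he⟩
      cases he
      change f' (f (Quotient.mk E x')) = _
      rw [show f (Quotient.mk E x') = Quotient.mk F y from h1]
      exact h2
  unfold IsBorelQuotientMap
  rw [this]
  refine MeasurableSet.image_of_countable_preimage (.inter ?_ ?_) (by fun_prop) ?_
  · exact (measurable_fst.prodMk (measurable_fst.comp measurable_snd)) hf
  · exact measurable_snd hf'
  · rintro ⟨x, z⟩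
    obtain ⟨y₀, hy₀⟩ := Quotient.exists_rep (f (Quotient.mk E x))
    refine ((hF.countable_class y₀).image fun y => (x, y, z)).mono ?_
    rintro ⟨x', y, z'⟩ ⟨⟨h1, -⟩, he⟩
    cases he
    exact ⟨y, Quotient.exact (hy₀.trans h1), rfl⟩

theorem IsBorelQuotientMap.symm {e : Quotient E ≃ Quotient F} (he : IsBorelQuotientMap E F e) :
    IsBorelQuotientMap F E e.symm := by
  have : {p : Y × X | e.symm (Quotient.mk F p.1) = Quotient.mk E p.2} =
      Prod.swap ⁻¹' {p : X × Y | e (Quotient.mk E p.1) = Quotient.mk F p.2} := by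
    ext p
    exact e.symm_apply_eq.trans eq_comm
  unfold IsBorelQuotientMap
  rw [this]
  exact measurable_swap he

end Quotients

/-! ### Schröder–Bernstein for quotients -/

/-- Glue `f` on `A` to the inverse of `g` off `A`. The set `A` is a parameter so that it can be
chosen Borel. -/
theorem exists_equiv_of_injective_of_fixed {α β : Type*} {f : α → β} {g : β → α}
    (hf : Function.Injective f) (hg : Function.Injective g) {A : Set α}
    (hA : ∀ a, a ∉ A ↔ ∃ b ∉ f '' A, g b = a) :
    ∃ h : α ≃ β, (∀ a ∈ A, h a = f a) ∧ ∀ a ∉ A, g (h a) = a := by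
  classical
  choose k hk using fun a : (Aᶜ : Set α) => (hA a).1 a.2
  let h : α → β := fun a => if ha : a ∈ A then f a else k ⟨a, ha⟩
  have h1 (a) (ha : a ∈ A) : h a = f a := dif_pos ha
  have h2 (a) (ha : a ∉ A) : h a ∉ f '' A ∧ g (h a) = a := by
    simp only [h, dif_neg ha]
    exact hk ⟨a, ha⟩
  refine ⟨Equiv.ofBijective h ⟨fun a a' he => ?_, fun b => ?_⟩, h1, fun a ha => (h2 a ha).2⟩
  · by_cases ha : a ∈ A <;> by_cases ha' : a' ∈ A
    · rw [h1 a ha, h1 a' ha'] at he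
      exact hf he
    · exact absurd (he ▸ (h1 a ha) ▸ mem_image_of_mem f ha) (h2 a' ha').1
    · exact absurd (he ▸ (h1 a' ha') ▸ mem_image_of_mem f ha') (h2 a ha).1
    · rw [← (h2 a ha).2, he, (h2 a' ha').2]
  · by_cases hb : b ∈ f '' A
    · obtain ⟨a, ha, rfl⟩ := hb
      exact ⟨a, h1 a ha⟩
    · exact ⟨g b, hg (h2 _ ((hA (g b)).2 ⟨b, hb, rfl⟩)).2⟩

/-- Schröder–Bernstein for quotients by countable Borel equivalence relations. -/
theorem BorelBireducible.exists_equiv {X Y : Type*} [MeasurableSpace X] [StandardBorelSpace X]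
    [MeasurableSpace Y] [StandardBorelSpace Y] {E : Setoid X} {F : Setoid Y} (hE : IsCBER E)
    (hF : IsCBER F) (h : BorelBireducible E F) :
    ∃ e : Quotient E ≃ Quotient F, IsBorelQuotientMap E F e := by
  obtain ⟨f, hfi, hf⟩ := h.1.exists_injective hF
  obtain ⟨g, hgi, hg⟩ := h.2.exists_injective hE
  -- The forward orbit of the complement of `range g` under `g ∘ f`: a countable union of Borel
  -- sets, unlike an abstract fixed point.
  let B : ℕ → Set (Quotient E) := fun n => (fun s => g '' (f '' s))^[n] (range g)ᶜ
  have hB (n : ℕ) : B (n + 1) = g '' (f '' B n) := Function.iterate_succ_apply' _ _ _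
  have hBm (n : ℕ) : MeasurableSet (B n) := by
    induction n with
    | zero =>
      refine MeasurableSet.compl ?_
      rw [← image_univ]
      exact hg.measurableSet_image hF hgi .univ
    | succ n ih =>
      rw [hB]
      exact hg.measurableSet_image hF hgi (hf.measurableSet_image hE hfi ih)
  let A := ⋃ n, B n
  have hA : MeasurableSet A := .iUnion hBm
  obtain ⟨e, he1, he2⟩ := exists_equiv_of_injective_of_fixed hfi hgi (A := A) fun a => by
    constructor
    · intro ha
      have h0 : a ∈ range g := by
        by_contra h0
        exact ha (mem_iUnion.2 ⟨0, h0⟩)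
      obtain ⟨b, rfl⟩ := h0
      refine ⟨b, ?_, rfl⟩
      rintro ⟨a', ha', rfl⟩
      obtain ⟨n, hn⟩ := mem_iUnion.1 ha'
      refine ha (mem_iUnion.2 ⟨n + 1, ?_⟩)
      rw [hB]
      exact mem_image_of_mem g (mem_image_of_mem f hn)
    · rintro ⟨b, hb, rfl⟩ ha
      obtain ⟨n, hn⟩ := mem_iUnion.1 ha
      cases n with
      | zero => exact hn (mem_range_self b)
      | succ n =>
        rw [hB] at hn
        obtain ⟨b', ⟨a, ha', rfl⟩, hbb⟩ := hn
        exact hb ⟨a, mem_iUnion.2 ⟨n, ha'⟩, hgi hbb⟩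
  refine ⟨e, ?_⟩
  have hA' : MeasurableSet {p : X × Y | Quotient.mk E p.1 ∈ A}  :=
    measurable_fst (show MeasurableSet (Quotient.mk E ⁻¹' A) from hA)
  have : {p : X × Y | e (Quotient.mk E p.1) = Quotient.mk F p.2} =
      ({p | Quotient.mk E p.1 ∈ A} ∩ {p | f (Quotient.mk E p.1) = Quotient.mk F p.2}) ∪
      ({p | Quotient.mk E p.1 ∈ A}ᶜ ∩
        Prod.swap ⁻¹' {p | g (Quotient.mk F p.1) = Quotient.mk E p.2}) := by
    ext ⟨x, y⟩
    by_cases hx : Quotient.mk E x ∈ A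
    · simp [hx, he1]
    · have := he2 _ hx
      simp only [mem_ofPred_eq, mem_union, mem_inter_iff, hx, false_and, mem_compl_iff,
        not_false_eq_true, mem_preimage, Prod.swap_prod_mk, true_and, false_or]
      rw [← hgi.eq_iff, this, eq_comm]
  unfold IsBorelQuotientMap
  rw [this]
  exact (hA'.inter hf).union (hA'.compl.inter (measurable_swap hg))

/-! ### Borel isomorphisms and direct sums -/

theorem BorelIsomorphic.trans {X Y Z : Type*} [MeasurableSpace X] [MeasurableSpace Y]
    [MeasurableSpace Z] {E : Setoid X} {F : Setoid Y} {H : Setoid Z} (h : BorelIsomorphic E F)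
    (h' : BorelIsomorphic F H) : BorelIsomorphic E H := by
  obtain ⟨T, hT⟩ := h
  obtain ⟨S, hS⟩ := h'
  exact ⟨T.trans S, fun x x' => (hT x x').trans (hS _ _)⟩

/-- The isomorphism is `v⁻¹ ∘ u`, Borel in both directions because `u` and `v` are embeddings. -/
theorem BorelIsomorphic.of_range_eq {X Y Z : Type*} [MeasurableSpace X] [MeasurableSpace Y]
    [MeasurableSpace Z] {E : Setoid X} {F : Setoid Y} (H : Setoid Z) {u : X → Z} {v : Y → Z}
    (hu : MeasurableEmbedding u) (hv : MeasurableEmbedding v) (huv : range u = range v)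
    (hE : ∀ x x', E x x' ↔ H (u x) (u x')) (hF : ∀ y y', F y y' ↔ H (v y) (v y')) :
    BorelIsomorphic E F := by
  choose T hT using fun x => (huv ▸ mem_range_self x : u x ∈ range v)
  choose S hS using fun y => (huv ▸ mem_range_self y : v y ∈ range u)
  have hTm : Measurable T := hv.measurable_comp_iff.1 (by
    rw [show v ∘ T = u from funext hT]
    exact hu.measurable)
  have hSm : Measurable S := hu.measurable_comp_iff.1 (by
    rw [show u ∘ S = v from funext hS]
    exact hv.measurable)
  refine ⟨⟨⟨T, S, fun x => ?_, fun y => ?_⟩, hTm, hSm⟩, fun x x' => ?_⟩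
  · exact hu.injective (by rw [hS, hT])
  · exact hv.injective (by rw [hT, hS])
  · rw [hE, hF, ← hT, ← hT]
    rfl

theorem measurableSet_sigma_iff {ι : Type*} {Y : ι → Type*} [∀ i, MeasurableSpace (Y i)]
    {s : Set (Σ i, Y i)} : MeasurableSet s ↔ ∀ i, MeasurableSet (Sigma.mk i ⁻¹' s) :=
  MeasurableSpace.measurableSet_iInf

theorem measurableEmbedding_sigmaMk {ι : Type*} {Y : ι → Type*} [∀ i, MeasurableSpace (Y i)]
    (i : ι) : MeasurableEmbedding (Sigma.mk i : Y i → Σ i, Y i) where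
  injective := sigma_mk_injective
  measurable := fun _ hs => measurableSet_sigma_iff.1 hs i
  measurableSet_image' := fun s hs => by
    refine measurableSet_sigma_iff.2 fun j => ?_
    by_cases hj : j = i
    · subst hj
      rwa [preimage_image_eq _ sigma_mk_injective]
    · convert! MeasurableSet.empty
      rw [eq_empty_iff_forall_notMem]
      rintro y ⟨z, -, hz⟩
      exact hj (congrArg Sigma.fst hz).symm

section DirectSigma

variable {ι : Type*} {Y : ι → Type*} (F : ∀ i, Setoid (Y i))

theorem Setoid.directSigma_mk_iff {i : ι} {x y : Y i} :
    Setoid.directSigma F ⟨i, x⟩ ⟨i, y⟩ ↔ F i x y := by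
  constructor
  · rintro ⟨j, x', y', h, hx, hy⟩
    cases hx
    cases hy
    exact h
  · exact fun h => ⟨i, x, y, h, rfl, rfl⟩

theorem Setoid.directSigma_fst_eq {p q : Σ i, Y i} (h : Setoid.directSigma F p q) :
    p.1 = q.1 := by
  obtain ⟨i, x, y, -, rfl, rfl⟩ := h
  rfl

/-- The quotient by a direct sum is the disjoint union of the quotients. -/
def Setoid.directSigmaQuotientEquiv : Quotient (Setoid.directSigma F) ≃ Σ i, Quotient (F i) where
  toFun := Quotient.lift (fun p => ⟨p.1, Quotient.mk (F p.1) p.2⟩) (by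
    rintro _ _ ⟨i, x, y, h, rfl, rfl⟩
    exact congrArg (Sigma.mk i) (Quotient.sound h))
  invFun p := Quotient.map (Sigma.mk p.1) (fun x y h => ⟨p.1, x, y, h, rfl, rfl⟩) p.2
  left_inv := by
    rintro ⟨p⟩
    rfl
  right_inv := by
    rintro ⟨i, ⟨x⟩⟩
    rfl

end DirectSigma

/-! ### Statement (1): translating the summands -/

theorem borelIsomorphic_of_outer {G : Type*} [Group G] [Countable G]
    {X : Type*} [MeasurableSpace X] [StandardBorelSpace X] (E : Setoid X)
    (houter : ∀ a : G →* Equiv.Perm (Quotient E), IsBorelAction E a → IsOuterAction E a)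
    (Y : G → Type*) [∀ g, MeasurableSpace (Y g)] [∀ g, StandardBorelSpace (Y g)]
    (F : ∀ g, Setoid (Y g)) (hF : ∀ g, IsCBER (F g))
    (hiso : BorelIsomorphic E (Setoid.directSigma F))
    (hbi : ∀ g h, BorelBireducible (F g) (F h)) (g h : G) : BorelIsomorphic (F g) (F h) := by
  -- Routing every identification through the base index 1 makes them coherent, so that translation
  -- in `G` is a genuine action.
  choose ψ hψ using fun k => (hbi 1 k).exists_equiv (hF 1) (hF k)
  obtain ⟨Φ, hΦ⟩ := hiso
  let W : Quotient E ≃ G × Quotient (F 1) :=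
    ((Quotient.congr Φ.toEquiv hΦ).trans (Setoid.directSigmaQuotientEquiv F)).trans
      ((Equiv.sigmaCongrRight fun k => (ψ k).symm).trans (Equiv.sigmaEquivProd _ _))
  have hW (x : X) : W (Quotient.mk E x) =
      ((Φ x).1, (ψ (Φ x).1).symm (Quotient.mk (F (Φ x).1) (Φ x).2)) := rfl
  let a : G →* Equiv.Perm (Quotient E) :=
    { toFun := fun k => (W.trans ((Equiv.mulLeft k).prodCongr (Equiv.refl _))).trans W.symm
      map_one' := by ext; simp
      map_mul' := fun k l => by ext; simp [Prod.map] }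
  have ha (k : G) (x x' : X) : a k (Quotient.mk E x) = Quotient.mk E x' ↔
      k * (Φ x).1 = (Φ x').1 ∧ (ψ (Φ x).1).symm (Quotient.mk (F (Φ x).1) (Φ x).2) =
        (ψ (Φ x').1).symm (Quotient.mk (F (Φ x').1) (Φ x').2) := by
    rw [← Prod.mk_inj, ← hW x']
    exact W.symm_apply_eq
  have hborel : IsBorelAction E a := by
    intro k
    let R (l : G) : Set (Y l × Y (k * l)) :=
      {p | (ψ (k * l) ∘ (ψ l).symm) (Quotient.mk (F l) p.1) = Quotient.mk (F (k * l)) p.2}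
    have hR (l : G) : MeasurableSet (R l) := (hψ (k * l)).comp (hF 1) (hψ l).symm
    -- The graph splits into countably many pieces, one for each `l`: the graph of `ψ (k * l) ∘ (ψ
    -- l).symm`.
    have : {p : X × X | a k (Quotient.mk E p.1) = Quotient.mk E p.2} =
        Prod.map Φ Φ ⁻¹' ⋃ l, Prod.map (Sigma.mk l) (Sigma.mk (k * l)) '' R l := by
      ext ⟨x, x'⟩
      simp only [mem_ofPred_eq, ha, mem_preimage, mem_iUnion, Prod.map_apply]
      generalize Φ x = p
      generalize Φ x' = q
      obtain ⟨l, y⟩ := p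
      obtain ⟨m, z⟩ := q
      constructor
      · rintro ⟨he, h⟩
        dsimp only at he
        subst he
        exact ⟨l, (y, z), (ψ (k * l)).eq_symm_apply.1 h, rfl⟩
      · rintro ⟨l', ⟨y', z'⟩, h, he⟩
        cases he
        exact ⟨rfl, (ψ (k * l)).eq_symm_apply.2 h⟩
    unfold IsBorelQuotientMap
    rw [this]
    refine (Φ.measurable.prodMap Φ.measurable) (.iUnion fun l => ?_)
    exact ((measurableEmbedding_sigmaMk l).prodMap
      (measurableEmbedding_sigmaMk (k * l))).measurableSet_image.2 (hR l)
  -- Left translation by `h * g⁻¹` sends index `g`, and no other, to `h`; so `T` maps the copy of `Y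
  -- g` onto that of `Y h`.
  obtain ⟨T, hTE, hT⟩ := houter a hborel (h * g⁻¹)
  have hTfst (x : X) : h * g⁻¹ * (Φ x).1 = (Φ (T x)).1 := ((ha _ _ _).1 (hT x)).1
  have hΦs (p q : Σ k, Y k) : Setoid.directSigma F p q ↔ E (Φ.symm p) (Φ.symm q) := by
    rw [hΦ]; simp
  refine BorelIsomorphic.of_range_eq E (u := T ∘ Φ.symm ∘ Sigma.mk g)
    (v := Φ.symm ∘ Sigma.mk h) ?_ ?_ ?_ ?_ ?_
  · exact T.measurableEmbedding.comp
      (Φ.symm.measurableEmbedding.comp (measurableEmbedding_sigmaMk g))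
  · exact Φ.symm.measurableEmbedding.comp (measurableEmbedding_sigmaMk h)
  · ext x
    constructor
    · rintro ⟨y, rfl⟩
      have := hTfst (Φ.symm ⟨g, y⟩)
      simp only [MeasurableEquiv.apply_symm_apply, inv_mul_cancel_right] at this
      subst this
      exact ⟨(Φ (T (Φ.symm ⟨g, y⟩))).2, Φ.symm_apply_apply _⟩
    · rintro ⟨y, rfl⟩
      have := hTfst (T.symm (Φ.symm ⟨h, y⟩))
      simp only [MeasurableEquiv.apply_symm_apply] at this
      rw [mul_assoc, mul_eq_left, inv_mul_eq_one] at this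
      subst this
      refine ⟨(Φ (T.symm (Φ.symm ⟨h, y⟩))).2, ?_⟩
      change T (Φ.symm (Φ _)) = Φ.symm ⟨h, y⟩
      simp
  · intro y y'
    rw [← Setoid.directSigma_mk_iff F, hΦs, hTE]
    rfl
  · intro y y'
    rw [← Setoid.directSigma_mk_iff F, hΦs]
    rfl

/-! ### Statement (2): compressibility -/

theorem Compressible.of_borelIsomorphic {X Y : Type*} [MeasurableSpace X] [MeasurableSpace Y]
    {E : Setoid X} {F : Setoid Y} (hF : Compressible F) (h : BorelIsomorphic E F) :
    Compressible E := by
  obtain ⟨S, hSm, hSi, hS⟩ := hF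
  obtain ⟨T, hT⟩ := h
  refine ⟨T.symm ∘ S ∘ T, T.symm.measurable.comp (hSm.comp T.measurable),
    T.symm.injective.comp (hSi.comp T.injective), fun x => ?_⟩
  have h1 : {y | E x y} = T.symm '' {y | F (T x) y} := by
    ext y
    rw [T.symm.image_eq_preimage_symm]
    exact hT x y
  have h2 : T '' {y | E x y} = {y | F (T x) y} := by
    rw [h1, image_image]
    simp
  rw [image_comp, image_comp, h2, h1]
  exact T.symm.injective.image_strictMono (hS (T x))

theorem compressible_prod_top {X : Type*} [MeasurableSpace X] (E : Setoid X) :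
    Compressible (E.prod (⊤ : Setoid ℕ)) := by
  refine ⟨fun p => (p.1, p.2 + 1), by fun_prop, ?_, ?_⟩
  · rintro ⟨x, m⟩ ⟨x', m'⟩ h
    simpa using h
  · rintro ⟨x, m⟩
    refine (ssubset_iff_of_subset ?_).2 ⟨(x, 0), ⟨E.refl x, trivial⟩, ?_⟩
    · rintro _ ⟨y, hy, rfl⟩
      exact ⟨hy.1, trivial⟩
    · rintro ⟨y, -, hy⟩
      exact Nat.succ_ne_zero _ (congrArg Prod.snd hy)

theorem compressible_directSigma {ι : Type*} {Y : ι → Type*} [∀ i, MeasurableSpace (Y i)]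
    {F : ∀ i, Setoid (Y i)} (hF : ∀ i, Compressible (F i)) :
    Compressible (Setoid.directSigma F) := by
  choose T hTm hTi hT using hF
  refine ⟨Sigma.map id T, fun s hs => measurableSet_sigma_iff.2 fun i => ?_,
    Function.injective_id.sigma_map hTi, ?_⟩
  · exact hTm i (measurableSet_sigma_iff.1 hs i)
  · rintro ⟨i, x⟩
    have h1 : {p | Setoid.directSigma F ⟨i, x⟩ p} = Sigma.mk i '' {y | F i x y} := by
      ext ⟨j, y⟩
      constructor
      · intro h
        obtain rfl : i = j := Setoid.directSigma_fst_eq F h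
        exact ⟨y, (Setoid.directSigma_mk_iff F).1 h, rfl⟩
      · rintro ⟨z, hz, he⟩
        cases he
        exact (Setoid.directSigma_mk_iff F).2 hz
    have h2 : Sigma.map id T '' (Sigma.mk i '' {y | F i x y}) =
        Sigma.mk i '' (T i '' {y | F i x y}) := by
      rw [image_image, image_image]
      rfl
    rw [h1, h2]
    exact sigma_mk_injective.image_strictMono (hT i x)

theorem IsCBER.comap {X Y : Type*} [MeasurableSpace X] [MeasurableSpace Y] {E : Setoid X}
    (hE : IsCBER E) {u : Y → X} (hu : Measurable u) (hinj : Function.Injective u) :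
    IsCBER (E.comap u) where
  measurableSet_rel := (hu.prodMap hu) hE.measurableSet_rel
  countable_class := fun y => (hE.countable_class (u y)).preimage hinj

/-- An equivalence relation is the direct sum of its restrictions to the members of a countable
partition into invariant Borel sets. -/
theorem borelIsomorphic_directSigma_restrict {ι X : Type*} [Countable ι] [MeasurableSpace X]
    (E : Setoid X) {A : ι → Set X} (hA : ∀ i, MeasurableSet (A i))
    (hdisj : Pairwise fun i j => Disjoint (A i) (A j)) (hcover : ⋃ i, A i = univ)
    (hinv : ∀ i, ∀ x ∈ A i, ∀ y, E x y → y ∈ A i) :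
    BorelIsomorphic E (Setoid.directSigma fun i => E.comap (Subtype.val : A i → X)) := by
  have hidx {i j : ι} {x : X} (hi : x ∈ A i) (hj : x ∈ A j) : i = j := by
    by_contra h
    exact disjoint_left.1 (hdisj h) hi hj
  refine .of_range_eq E (u := id) (v := fun p : Σ i, A i => (p.2 : X)) .id
    ⟨?_, ?_, ?_⟩ ?_ (fun _ _ => Iff.rfl) ?_
  · rintro ⟨i, x, hx⟩ ⟨j, y, hy⟩ h
    dsimp only at h
    subst h
    obtain rfl := hidx hx hy
    rfl
  · exact fun s hs => measurableSet_sigma_iff.2 fun i => measurable_subtype_coe hs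
  · intro s hs
    have : (fun p : Σ i, A i => (p.2 : X)) '' s =
        ⋃ i, (Subtype.val : A i → X) '' ((fun x => ⟨i, x⟩) ⁻¹' s) := by
      ext x
      simp
    rw [this]
    exact .iUnion fun i => (hA i).subtype_image (measurableSet_sigma_iff.1 hs i)
  · rw [range_id, eq_comm, eq_univ_iff_forall]
    intro x
    obtain ⟨i, hi⟩ := mem_iUnion.1 (hcover ▸ mem_univ x : x ∈ ⋃ i, A i)
    exact ⟨⟨i, x, hi⟩, rfl⟩
  · rintro ⟨i, x, hx⟩ ⟨j, y, hy⟩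
    constructor
    · intro h
      obtain rfl : i = j := Setoid.directSigma_fst_eq _ h
      exact (Setoid.directSigma_mk_iff _).1 h
    · intro h
      obtain rfl := hidx (hinv i x hx y h) hy
      exact (Setoid.directSigma_mk_iff _).2 h

theorem measurableEmbedding_inl {X Y : Type*} [MeasurableSpace X] [MeasurableSpace Y] :
    MeasurableEmbedding (Sum.inl : X → X ⊕ Y) :=
  ⟨Sum.inl_injective, measurable_inl, fun _ hs => hs.inl_image⟩

theorem measurableEmbedding_inr {X Y : Type*} [MeasurableSpace X] [MeasurableSpace Y] :
    MeasurableEmbedding (Sum.inr : Y → X ⊕ Y) :=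
  ⟨Sum.inr_injective, measurable_inr, fun _ hs => measurableSet_inr_image.2 hs⟩

/-- Absorbing `C` as a summand yields infinitely many disjoint invariant copies of `C`. -/
theorem exists_embeddings_of_borelIsomorphic_directSum {X Z : Type*} [MeasurableSpace X]
    [MeasurableSpace Z] {E : Setoid X} {C : Setoid Z}
    (h : BorelIsomorphic E (Setoid.directSum E C)) :
    ∃ e : ℕ → Z → X, (∀ n, MeasurableEmbedding (e n)) ∧
      (∀ n p q, C p q ↔ E (e n p) (e n q)) ∧
      (∀ n p x, E (e n p) x → x ∈ range (e n)) ∧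
      Pairwise fun m n => Disjoint (range (e m)) (range (e n)) := by
  obtain ⟨Φ, hΦ⟩ := h
  let i : X → X := Φ.symm ∘ Sum.inl
  let j : Z → X := Φ.symm ∘ Sum.inr
  have hi : MeasurableEmbedding i := Φ.symm.measurableEmbedding.comp measurableEmbedding_inl
  have hj : MeasurableEmbedding j := Φ.symm.measurableEmbedding.comp measurableEmbedding_inr
  have hiE (x y : X) : E x y ↔ E (i x) (i y) := by
    rw [hΦ (i x)]
    simp only [i, Function.comp_apply, MeasurableEquiv.apply_symm_apply]
    exact Sum.liftRel_inl_inl.symm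
  have hjE (p q : Z) : C p q ↔ E (j p) (j q) := by
    rw [hΦ (j p)]
    simp only [j, Function.comp_apply, MeasurableEquiv.apply_symm_apply]
    exact Sum.liftRel_inr_inr.symm
  have hiI (x y : X) (h : E (i x) y) : y ∈ range i := by
    rw [hΦ] at h
    simp only [i, Function.comp_apply, MeasurableEquiv.apply_symm_apply] at h
    refine (?_ : ∀ s, s = Φ y → y ∈ range i) _ rfl
    rintro (z | z) hz
    · exact ⟨z, Φ.symm_apply_eq.2 hz⟩
    · rw [← hz] at h
      exact absurd h Sum.not_liftRel_inl_inr
  have hjI (p : Z) (y : X) (h : E (j p) y) : y ∈ range j := by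
    rw [hΦ] at h
    simp only [j, Function.comp_apply, MeasurableEquiv.apply_symm_apply] at h
    refine (?_ : ∀ s, s = Φ y → y ∈ range j) _ rfl
    rintro (z | z) hz
    · rw [← hz] at h
      exact absurd h Sum.not_liftRel_inr_inl
    · exact ⟨z, Φ.symm_apply_eq.2 hz⟩
  have hij (x : X) (p : Z) : i x ≠ j p := fun h => Sum.inl_ne_inr (Φ.symm.injective h)
  -- The ranges of `i` and `j` are invariant and disjoint, and `i` is injective, so the iterates of
  -- `i` move the copy `j` to disjoint invariant copies.
  let e : ℕ → Z → X := fun n => i^[n] ∘ j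
  have he (n : ℕ) (p : Z) : e (n + 1) p = i (e n p) := Function.iterate_succ_apply' _ _ _
  have hlt {m n : ℕ} (hmn : m < n) : Disjoint (range (e m)) (range (e n)) := by
    obtain ⟨d, rfl⟩ := Nat.exists_eq_add_of_lt hmn
    rw [disjoint_left]
    rintro _ ⟨p, rfl⟩ ⟨q, hq⟩
    have : e (m + d + 1) q = i^[m] (e (d + 1) q) := by
      simp only [e, Function.comp_apply]
      rw [← Function.iterate_add_apply, Nat.add_assoc]
    rw [this] at hq
    have h := hi.injective.iterate m hq
    rw [he] at h
    exact hij _ _ h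
  refine ⟨e, fun n => ?_, fun n p q => ?_, fun n => ?_, fun m n hmn => ?_⟩
  · induction n with
    | zero => exact hj
    | succ n ih => exact (funext (he n) : e (n + 1) = i ∘ e n) ▸ hi.comp ih
  · induction n with
    | zero => exact hjE p q
    | succ n ih => rw [he, he, ← hiE, ih]
  · induction n with
    | zero => exact hjI
    | succ n ih =>
      intro p x h
      rw [he] at h
      obtain ⟨y, rfl⟩ := hiI _ _ h
      obtain ⟨q, rfl⟩ := ih p y ((hiE _ _).2 h)
      exact ⟨q, he n q⟩
  · rcases lt_or_gt_of_ne hmn with h | h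
    · exact hlt h
    · exact (hlt h).symm

theorem compressible_of_outer {G : Type*} [Group G] [Countable G] [Nontrivial G]
    {X : Type*} [MeasurableSpace X] [StandardBorelSpace X] (E : Setoid X) (hE : IsCBER E)
    (houter : ∀ a : G →* Equiv.Perm (Quotient E), IsBorelAction E a → IsOuterAction E a)
    (h : BorelIsomorphic E (Setoid.directSum E (Setoid.prod E (⊤ : Setoid ℕ)))) :
    Compressible E := by
  classical
  obtain ⟨e, hem, heE, heI, hed⟩ := exists_embeddings_of_borelIsomorphic_directSum h
  obtain ⟨n, hn⟩ := Countable.exists_injective_nat G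
  let R : G → Set X := fun g => range (e (n g))
  have hR (g : G) : MeasurableSet (R g) := (hem _).measurableSet_range
  have hRd {g k : G} (hgk : g ≠ k) : Disjoint (R g) (R k) := hed (hn.ne hgk)
  have hRI (g : G) (x) (hx : x ∈ R g) (y) (hxy : E x y) : y ∈ R g := by
    obtain ⟨p, rfl⟩ := hx
    exact heI _ p y hxy
  -- The piece at 1 takes everything outside the other copies, so the pieces partition `X` while
  -- those at `g ≠ 1` remain exact copies.
  let A : G → Set X := fun g => if g = 1 then (⋃ k : {k : G // k ≠ 1}, R k)ᶜ else R g
  have hA1 : A 1 = (⋃ k : {k : G // k ≠ 1}, R k)ᶜ := if_pos rfl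
  have hAne {g : G} (hg : g ≠ 1) : A g = R g := if_neg hg
  have hAm (g : G) : MeasurableSet (A g) := by
    by_cases hg : g = 1
    · rw [hg, hA1]
      exact (MeasurableSet.iUnion fun k : {k : G // k ≠ 1} => hR k).compl
    · exact hAne hg ▸ hR g
  have hRA (g : G) : R g ⊆ A g := by
    by_cases hg : g = 1
    · rw [hg, hA1, subset_compl_iff_disjoint_right, disjoint_iUnion_right]
      exact fun k => hRd k.2.symm
    · exact (hAne hg).ge
  have hA1d {g : G} (hg : g ≠ 1) : Disjoint (A 1) (A g) := by
    rw [hA1, hAne hg]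
    exact disjoint_compl_left_iff_subset.2 (subset_iUnion (fun k : {k : G // k ≠ 1} => R k) ⟨g, hg⟩)
  have hAd : Pairwise fun g k => Disjoint (A g) (A k) := by
    intro g k hgk
    by_cases hg : g = 1
    · subst hg
      exact hA1d hgk.symm
    by_cases hk : k = 1
    · subst hk
      exact (hA1d hg).symm
    rw [hAne hg, hAne hk]
    exact hRd hgk
  have hAc : ⋃ g, A g = univ := by
    refine eq_univ_iff_forall.2 fun x => mem_iUnion.2 ?_
    by_cases hx : x ∈ A 1
    · exact ⟨1, hx⟩
    · rw [hA1, notMem_compl_iff] at hx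
      obtain ⟨k, hk⟩ := mem_iUnion.1 hx
      exact ⟨k, hRA k hk⟩
  have hAI (g : G) (x) (hx : x ∈ A g) (y) (hxy : E x y) : y ∈ A g := by
    by_cases hg : g = 1
    · subst hg
      rw [hA1] at hx ⊢
      intro hy
      obtain ⟨k, hk⟩ := mem_iUnion.1 hy
      exact hx (mem_iUnion.2 ⟨k, hRI k y hk x (E.symm hxy)⟩)
    · rw [hAne hg] at hx ⊢
      exact hRI g x hx y hxy
  let F (g : G) : Setoid (A g) := E.comap (Subtype.val : A g → X)
  have hFsb (g : G) : StandardBorelSpace (A g) := (hAm g).standardBorel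
  have hF (g : G) : IsCBER (F g) := hE.comap measurable_subtype_coe Subtype.val_injective
  have hEF : BorelIsomorphic E (Setoid.directSigma F) :=
    borelIsomorphic_directSigma_restrict E hAm hAd hAc hAI
  -- Each piece sits in `E`, and `E` reduces to the copy inside any other piece through its level 0.
  have hbi (g k : G) : BorelReducible (F g) (F k) := by
    refine ⟨fun x => ⟨e (n k) (x, 0), hRA k (mem_range_self _)⟩, ?_, fun x x' => ?_⟩
    · exact ((hem _).measurable.comp (measurable_subtype_coe.prodMk measurable_const)).subtype_mk
    · change E x x' ↔ E (e (n k) (x, 0)) (e (n k) (x', 0))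
      rw [← heE]
      exact (and_iff_left trivial).symm
  have hiso := borelIsomorphic_of_outer E houter (fun g => A g) F hF hEF
    fun g k => ⟨hbi g k, hbi k g⟩
  -- Away from 1 the piece is exactly E × I_ℕ, and its compressibility passes to all the pieces.
  obtain ⟨g₀, hg₀⟩ := exists_ne (1 : G)
  have hprod : BorelIsomorphic (F g₀) (E.prod (⊤ : Setoid ℕ)) := by
    refine .of_range_eq E (u := Subtype.val) (.subtype_coe (hAm g₀)) (hem (n g₀)) ?_
      (fun _ _ => Iff.rfl) (heE _)
    rw [Subtype.range_val, hAne hg₀]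
  exact (compressible_directSigma fun g =>
    (compressible_prod_top E).of_borelIsomorphic ((hiso g g₀).trans hprod)).of_borelIsomorphic hEF

theorem mainTheorem7 {G : Type*} [Group G] [Countable G]
    {X : Type*} [MeasurableSpace X] [StandardBorelSpace X]
    (E : Setoid X) (hE : IsCBER E)
    (houter : ∀ a : G →* Equiv.Perm (Quotient E), IsBorelAction E a → IsOuterAction E a) :
    (∀ (Y : G → Type*) [∀ g, MeasurableSpace (Y g)] [∀ g, StandardBorelSpace (Y g)]
        (F : ∀ g, Setoid (Y g)),
        (∀ g, IsCBER (F g)) →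
        BorelIsomorphic E (Setoid.directSigma F) →
        (∀ g h, BorelBireducible (F g) (F h)) →
        ∀ g h, BorelIsomorphic (F g) (F h)) ∧
    (Nontrivial G →
        BorelIsomorphic E (Setoid.directSum E (Setoid.prod E (⊤ : Setoid ℕ))) →
        Compressible E) :=
  ⟨fun Y _ _ F hF hiso hbi => borelIsomorphic_of_outer E houter Y F hF hiso hbi,
    fun _ h => compressible_of_outer E hE houter h⟩
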